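/- For a finite simple graph $G$ with vertex set $\{0,\dots,n-1\}$ and adjacency matrix $A$, let $\theta_0,\dots,\theta_d$ be the distinct eigenvalues of $A$, let $E_r$ be the matrix of the orthogonal projection onto the $\theta_r$-eigenspace, and let $$\widehat{M}=\sum_{r=0}^{d} E_r\circ E_r$$ be the average mixing matrix of $G$, where $\circ$ denotes the entrywise product. Theorem. The numerators and denominators of the entries of the average mixing matrix are computable in exact arithmetic. Precisely, there is a single algorithm (a total computable function) which, given the 0-1 adjacency matrix of a finite simple graph $G$ on $n$ vertices, for any $n$, and two vertices $a,b$ of $G$, possibly equal, outputs integers $p$ and $q>0$ with $\gcd(p,q)=1$ and $$\widehat{M}_{a,b}=\frac{p}{q}=\lim_{T\to\infty}\frac1T\int_0^T \bigl(e^{\mathrm{i}tA}\bigr)_{a,b}\bigl(e^{-\mathrm{i}tA}\bigr)_{a,b}\,dt .$$ In particular every entry of $\widehat{M}$ is rational. -/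

import Mathlib

open Filter Topology

noncomputable section

namespace QuantumWalk

/-- The matrix of the orthogonal projection of Euclidean space onto the `θ`-eigenspace of the
real square matrix `A`. -/
def eigenprojection {n : ℕ} (A : Matrix (Fin n) (Fin n) ℝ) (θ : ℝ) :
    Matrix (Fin n) (Fin n) ℝ :=
  Matrix.of fun a b =>
    (Module.End.eigenspace (Matrix.toEuclideanLin A) θ).starProjection
      (EuclideanSpace.single b 1) a

/-- The average mixing matrix of the graph `G`: the sum, over the distinct eigenvalues `θ` of the
adjacency matrix, of the entrywise squares of the projections onto the eigenspaces. -/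
def averageMixingMatrix {n : ℕ} (G : SimpleGraph (Fin n)) [DecidableRel G.Adj] :
    Matrix (Fin n) (Fin n) ℝ :=
  ∑ θ ∈ (G.adjMatrix ℝ).charpoly.roots.toFinset,
    Matrix.hadamard (eigenprojection (G.adjMatrix ℝ) θ) (eigenprojection (G.adjMatrix ℝ) θ)

/-- The transition matrix `exp(i t A)` of the continuous-time quantum walk on `G`. -/
def transitionMatrix {n : ℕ} (G : SimpleGraph (Fin n)) [DecidableRel G.Adj] (t : ℝ) :
    Matrix (Fin n) (Fin n) ℂ :=
  NormedSpace.exp ((Complex.I * (t : ℂ)) • G.adjMatrix ℂ)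

/-- The mixing matrix `exp(i t A) ∘ exp(-i t A)` at time `t`, with the entrywise product. -/
def mixingMatrix {n : ℕ} (G : SimpleGraph (Fin n)) [DecidableRel G.Adj] (t : ℝ) :
    Matrix (Fin n) (Fin n) ℂ :=
  Matrix.hadamard (transitionMatrix G t) (transitionMatrix G (-t))

/-- The rows of the 0-1 adjacency matrix of `G`, as a finite list of lists of bits: the form in
which an algorithm receives the graph. -/
def adjacencyRows {n : ℕ} (G : SimpleGraph (Fin n)) [DecidableRel G.Adj] : List (List Bool) :=
  List.ofFn fun i => List.ofFn fun j => decide (G.Adj i j)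

end QuantumWalk

end

namespace QuantumWalk

/-! ### Spectral projections of a real symmetric matrix. -/

open Matrix Module.End

/-! No eigenvalue is ever computed. With `D = single b b 1`, the requested entry is the `(a, a)`
entry of `∑ E_θ D E_θ`. This sum is the only matrix `X` such that `X` commutes with `A` and `D - X`
is a commutator `A Y - Y A` (`sum_eigenprojection_mul_mul`), which is a linear system with rational
coefficients.

The system is solvable over `ℚ`: for symmetric `A`, the map `Y ↦ A Y - Y A` is self-adjoint for the
positive definite trace form, so its kernel and range are complementary
(`disjoint_ker_range_commutatorMap`). Clearing denominators leaves an integer certificate `(q, X,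
Y)` that is checked by natural number arithmetic. Certificates exist for every input
(`exists_isCertificate`), so unbounded search is total, and any certificate found yields the correct
reduced fraction (`IsCertificate.averageMixingMatrix_eq`).

The limit is separate: expanding `exp(itA)` spectrally, the time average kills every term with `θ ≠
η`. -/

theorem toEuclideanLin_eigenprojection {n : ℕ} (A : Matrix (Fin n) (Fin n) ℝ) (θ : ℝ) :
    Matrix.toEuclideanLin (eigenprojection A θ) =
      ((eigenspace (Matrix.toEuclideanLin A) θ).starProjection :
        EuclideanSpace ℝ (Fin n) →ₗ[ℝ] EuclideanSpace ℝ (Fin n)) := by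
  refine (EuclideanSpace.basisFun (Fin n) ℝ).toBasis.ext fun b => ?_
  ext a
  simp [eigenprojection, Matrix.toLpLin_apply]

theorem mem_roots_charpoly_iff {n : ℕ} (A : Matrix (Fin n) (Fin n) ℝ) (θ : ℝ) :
    θ ∈ A.charpoly.roots.toFinset ↔ HasEigenvalue (Matrix.toEuclideanLin A) θ := by
  rw [hasEigenvalue_iff_isRoot_charpoly, Matrix.toEuclideanLin, Matrix.toLpLin_eq_toLin,
    Matrix.charpoly_toLin, Multiset.mem_toFinset, Polynomial.mem_roots A.charpoly_monic.ne_zero]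

theorem mul_eigenprojection {n : ℕ} (A : Matrix (Fin n) (Fin n) ℝ) (θ : ℝ) :
    A * eigenprojection A θ = θ • eigenprojection A θ := by
  apply Matrix.toEuclideanLin.injective
  rw [map_smul, toEuclideanLin_eigenprojection, Matrix.toLpLin_mul _ 2,
    toEuclideanLin_eigenprojection]
  ext1 v
  exact mem_eigenspace_iff.1 (Submodule.starProjection_apply_mem
    (eigenspace (Matrix.toEuclideanLin A) θ) v)

theorem eigenprojection_mul_of_mul_eq_smul {n : ℕ} {A M : Matrix (Fin n) (Fin n) ℝ} {θ : ℝ}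
    (h : A * M = θ • M) : eigenprojection A θ * M = M := by
  apply Matrix.toEuclideanLin.injective
  rw [Matrix.toLpLin_mul _ 2, toEuclideanLin_eigenprojection]
  ext1 v
  refine Submodule.starProjection_eq_self_iff.2 (mem_eigenspace_iff.2 ?_)
  rw [← LinearMap.comp_apply, ← Matrix.toLpLin_mul, h, map_smul, LinearMap.smul_apply]

theorem eigenprojection_transpose {n : ℕ} (A : Matrix (Fin n) (Fin n) ℝ) (θ : ℝ) :
    (eigenprojection A θ)ᵀ = eigenprojection A θ := by
  have : (eigenprojection A θ).IsHermitian := by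
    rw [← Matrix.isSymmetric_toEuclideanLin_iff, toEuclideanLin_eigenprojection]
    exact Submodule.starProjection_isSymmetric (eigenspace (Matrix.toEuclideanLin A) θ)
  simpa using this.eq

theorem eigenprojection_mul {n : ℕ} {A : Matrix (Fin n) (Fin n) ℝ} (hA : A.IsHermitian) (θ : ℝ) :
    eigenprojection A θ * A = θ • eigenprojection A θ := by
  have hA' : Aᵀ = A := by simpa using hA.eq
  have h := congrArg Matrix.transpose (mul_eigenprojection A θ)
  rwa [Matrix.transpose_mul, Matrix.transpose_smul, eigenprojection_transpose, hA'] at h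

/-- Tested on an orthonormal eigenbasis: each eigenvector is fixed by its own projection and killed
by the others, since distinct eigenspaces are orthogonal. -/
theorem sum_eigenprojection {n : ℕ} {A : Matrix (Fin n) (Fin n) ℝ} (hA : A.IsHermitian) :
    ∑ θ ∈ A.charpoly.roots.toFinset, eigenprojection A θ = 1 := by
  have hs := Matrix.isSymmetric_toEuclideanLin_iff.2 hA
  apply Matrix.toEuclideanLin.injective
  refine (hs.eigenvectorBasis finrank_euclideanSpace).toBasis.ext fun i => ?_
  have hv := hs.hasEigenvector_eigenvectorBasis finrank_euclideanSpace i
  set v := hs.eigenvectorBasis finrank_euclideanSpace i with hvdef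
  set μ : ℝ := hs.eigenvalues finrank_euclideanSpace i
  have hμ : μ ∈ A.charpoly.roots.toFinset :=
    (mem_roots_charpoly_iff A μ).2 (hasEigenvalue_of_hasEigenvector hv)
  rw [OrthonormalBasis.coe_toBasis, ← hvdef, map_sum, LinearMap.sum_apply,
    Finset.sum_eq_single_of_mem μ hμ]
  · rw [toEuclideanLin_eigenprojection, Matrix.toLpLin_one]
    exact Submodule.starProjection_eq_self_iff.2 hv.1
  · intro θ _ hθ
    rw [toEuclideanLin_eigenprojection]
    refine (Submodule.starProjection_apply_eq_zero_iff _).2 fun w hw => ?_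
    exact hs.orthogonalFamily_eigenspaces hθ ⟨w, hw⟩ ⟨v, hv.1⟩

/-- A matrix `X` commuting with `A`, such that `q • D - X` is a commutator with `A`, is the
`q`-fold of the sum of the compressions of `D` to the eigenspaces of `A`. -/
theorem sum_eigenprojection_mul_mul {n : ℕ} {A D X Y : Matrix (Fin n) (Fin n) ℝ} {q : ℝ}
    (hA : A.IsHermitian) (hX : A * X = X * A) (hY : q • D - X = A * Y - Y * A) :
    q • ∑ θ ∈ A.charpoly.roots.toFinset, eigenprojection A θ * D * eigenprojection A θ = X := by
  have hXE : ∑ θ ∈ A.charpoly.roots.toFinset, eigenprojection A θ * X * eigenprojection A θ =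
      ∑ θ ∈ A.charpoly.roots.toFinset, q • (eigenprojection A θ * D * eigenprojection A θ) := by
    refine Finset.sum_congr rfl fun θ _ => ?_
    -- Compression kills commutators: `E A Y E` and `E Y A E` both equal `θ • E Y E`.
    have h : X = q • D - (A * Y - Y * A) := by rw [← hY]; abel
    rw [h, Matrix.mul_sub, Matrix.mul_sub, ← Matrix.mul_assoc, eigenprojection_mul hA,
      Matrix.sub_mul, Matrix.sub_mul, ← Matrix.mul_assoc _ Y A, Matrix.mul_assoc _ A,
      mul_eigenprojection]
    simp
  rw [Finset.smul_sum, ← hXE]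
  -- As `X` commutes with `A`, the columns of `X E` are again `θ`-eigenvectors, hence fixed by `E`;
  -- the sum over `θ` then collapses to `X`.
  have hterm : ∀ θ ∈ A.charpoly.roots.toFinset,
      eigenprojection A θ * X * eigenprojection A θ = X * eigenprojection A θ := by
    intro θ _
    rw [Matrix.mul_assoc]
    apply eigenprojection_mul_of_mul_eq_smul
    rw [← Matrix.mul_assoc, hX, Matrix.mul_assoc, mul_eigenprojection, Matrix.mul_smul]
  rw [Finset.sum_congr rfl hterm, ← Finset.mul_sum, sum_eigenprojection hA, Matrix.mul_one]

theorem averageMixingMatrix_apply {n : ℕ} (G : SimpleGraph (Fin n)) [DecidableRel G.Adj]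
    (a b : Fin n) :
    averageMixingMatrix G a b =
      ∑ θ ∈ (G.adjMatrix ℝ).charpoly.roots.toFinset, eigenprojection (G.adjMatrix ℝ) θ a b ^ 2 := by
  simp [averageMixingMatrix, Matrix.sum_apply, sq]

/-- Compressing the rank one matrix at `b` gives `(E D E) a a = E a b * E b a`, a square by symmetry
of `E`. -/
theorem mul_sum_eigenprojection_sq {n : ℕ} {A X Y : Matrix (Fin n) (Fin n) ℝ} {q : ℝ} {b : Fin n}
    (hA : A.IsHermitian) (hX : A * X = X * A)
    (hY : q • Matrix.single b b 1 - X = A * Y - Y * A) (a : Fin n) :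
    q * ∑ θ ∈ A.charpoly.roots.toFinset, eigenprojection A θ a b ^ 2 = X a a := by
  rw [← congrFun (congrFun (sum_eigenprojection_mul_mul hA hX hY) a) a, Matrix.smul_apply,
    Matrix.sum_apply, smul_eq_mul]
  congr 1
  refine Finset.sum_congr rfl fun θ _ => ?_
  have h : eigenprojection A θ b a = eigenprojection A θ a b :=
    congrFun (congrFun (eigenprojection_transpose A θ) a) b
  rw [Matrix.mul_apply, Finset.sum_eq_single b]
  · rw [Matrix.mul_single_apply_same, h]; ring
  · intro k _ hk
    rw [Matrix.mul_single_apply_of_ne _ _ _ _ _ hk, zero_mul]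
  · simp

/-! ### The quantum walk and its time average. -/

theorem exp_mul_of_mul_eq_smul {n : ℕ} {M E : Matrix (Fin n) (Fin n) ℂ} {c : ℂ}
    (h : M * E = c • E) : NormedSpace.exp M * E = Complex.exp c • E := by
  -- The norm serves only to sum the exponential series, which is then compared termwise.
  let _ : NormedRing (Matrix (Fin n) (Fin n) ℂ) := Matrix.linftyOpNormedRing
  let _ : NormedAlgebra ℂ (Matrix (Fin n) (Fin n) ℂ) := Matrix.linftyOpNormedAlgebra
  have hpow : ∀ k : ℕ, M ^ k * E = c ^ k • E := by
    intro k
    induction k with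
    | zero => simp
    | succ k ih => rw [pow_succ, Matrix.mul_assoc, h, Matrix.mul_smul, ih, smul_smul, pow_succ']
  have h1 := (NormedSpace.exp_series_hasSum_exp' (𝕂 := ℂ) M).mul_right E
  have h2 := (NormedSpace.exp_series_hasSum_exp' (𝕂 := ℂ) c).smul_const E
  rw [← Complex.exp_eq_exp_ℂ] at h2
  refine h1.unique (h2.congr_fun ?_)
  intro k
  simp [hpow, smul_smul]

theorem transitionMatrix_apply {n : ℕ} (G : SimpleGraph (Fin n)) [DecidableRel G.Adj] (t : ℝ)
    (a b : Fin n) :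
    transitionMatrix G t a b = ∑ θ ∈ (G.adjMatrix ℝ).charpoly.roots.toFinset,
      Complex.exp (Complex.I * t * θ) * (eigenprojection (G.adjMatrix ℝ) θ a b : ℂ) := by
  have hA : (G.adjMatrix ℝ).IsHermitian := by
    simp [Matrix.IsHermitian, Matrix.conjTranspose_eq_transpose_of_trivial]
  have hone : ∑ θ ∈ (G.adjMatrix ℝ).charpoly.roots.toFinset,
      (eigenprojection (G.adjMatrix ℝ) θ).map Complex.ofRealHom = 1 := by
    have := congrArg (Complex.ofRealHom.mapMatrix) (sum_eigenprojection hA)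
    simpa using this
  have hmap : G.adjMatrix ℂ = (G.adjMatrix ℝ).map Complex.ofRealHom := by
    ext i j; by_cases h : G.Adj i j <;> simp [SimpleGraph.adjMatrix_apply, h]
  have hE : ∀ θ : ℝ, ((Complex.I * (t : ℂ)) • G.adjMatrix ℂ) *
      (eigenprojection (G.adjMatrix ℝ) θ).map Complex.ofRealHom =
      (Complex.I * t * θ) • (eigenprojection (G.adjMatrix ℝ) θ).map Complex.ofRealHom := by
    intro θ
    rw [hmap, Matrix.smul_mul, ← Matrix.map_mul, mul_eigenprojection, mul_smul _ (θ : ℂ)]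
    congr 1
    ext i j
    simp
  rw [transitionMatrix, ← Matrix.mul_one (NormedSpace.exp _), ← hone, Finset.mul_sum,
    Matrix.sum_apply]
  refine Finset.sum_congr rfl fun θ _ => ?_
  rw [exp_mul_of_mul_eq_smul (hE θ)]
  simp

/-- For `c ≠ 0` the integral stays bounded by `2 / |c|`, so dividing by `T` sends it to zero. -/
theorem tendsto_average_exp (c : ℝ) :
    Tendsto (fun T : ℝ => ((1 / T : ℝ) : ℂ) * ∫ t in (0 : ℝ)..T, Complex.exp (Complex.I * c * t))
      atTop (𝓝 (if c = 0 then 1 else 0)) := by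
  split_ifs with hc
  · subst hc
    refine tendsto_const_nhds.congr' ?_
    filter_upwards [eventually_gt_atTop (0 : ℝ)] with T hT
    have : (T : ℂ) ≠ 0 := by exact_mod_cast hT.ne'
    simp [this]
  · have hne : Complex.I * (c : ℂ) ≠ 0 := by simp [hc]
    have hinv : Tendsto (fun T : ℝ => 2 / |c| * (1 / T)) atTop (𝓝 0) := by
      simpa using (tendsto_inv_atTop_zero (𝕜 := ℝ)).const_mul (2 / |c|)
    refine squeeze_zero_norm' ?_ hinv
    filter_upwards [eventually_gt_atTop (0 : ℝ)] with T hT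
    rw [integral_exp_mul_complex hne, norm_mul, norm_div, mul_comm]
    have h1 : ‖((1 / T : ℝ) : ℂ)‖ = 1 / T := by
      rw [Complex.norm_real, Real.norm_of_nonneg (by positivity)]
    have h2 : ‖Complex.I * (c : ℂ)‖ = |c| := by simp
    rw [h1, h2]
    gcongr
    refine (norm_sub_le _ _).trans ?_
    have h3 : ∀ s : ℝ, ‖Complex.exp (Complex.I * c * s)‖ = 1 := by
      intro s
      rw [Complex.norm_exp]
      simp
    rw [h3, h3]
    norm_num

theorem mixingMatrix_apply {n : ℕ} (G : SimpleGraph (Fin n)) [DecidableRel G.Adj] (t : ℝ)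
    (a b : Fin n) :
    mixingMatrix G t a b = ∑ θ ∈ (G.adjMatrix ℝ).charpoly.roots.toFinset,
      ∑ η ∈ (G.adjMatrix ℝ).charpoly.roots.toFinset,
        ((eigenprojection (G.adjMatrix ℝ) θ a b * eigenprojection (G.adjMatrix ℝ) η a b : ℝ) : ℂ) *
          Complex.exp (Complex.I * ((θ - η : ℝ) : ℂ) * t) := by
  rw [mixingMatrix, Matrix.hadamard_apply, transitionMatrix_apply, transitionMatrix_apply,
    Finset.sum_mul_sum]
  refine Finset.sum_congr rfl fun θ _ => Finset.sum_congr rfl fun η _ => ?_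
  have : Complex.I * ((θ - η : ℝ) : ℂ) * t =
      Complex.I * t * θ + Complex.I * ((-t : ℝ) : ℂ) * η := by
    push_cast; ring
  rw [this, Complex.exp_add]
  push_cast
  ring

theorem tendsto_average_mixingMatrix {n : ℕ} (G : SimpleGraph (Fin n)) [DecidableRel G.Adj]
    (a b : Fin n) :
    Tendsto (fun T : ℝ => ((1 / T : ℝ) : ℂ) * ∫ t in (0 : ℝ)..T, mixingMatrix G t a b)
      atTop (𝓝 (averageMixingMatrix G a b : ℂ)) := by
  set S := (G.adjMatrix ℝ).charpoly.roots.toFinset with hS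
  set e : ℝ → ℝ := fun θ => eigenprojection (G.adjMatrix ℝ) θ a b with he
  have hlim : Tendsto (fun T : ℝ => ∑ θ ∈ S, ∑ η ∈ S, ((e θ * e η : ℝ) : ℂ) *
      (((1 / T : ℝ) : ℂ) * ∫ t in (0 : ℝ)..T, Complex.exp (Complex.I * ((θ - η : ℝ) : ℂ) * t)))
      atTop (𝓝 (∑ θ ∈ S, ∑ η ∈ S, ((e θ * e η : ℝ) : ℂ) * (if θ - η = 0 then 1 else 0))) :=
    tendsto_finsetSum _ fun θ _ => tendsto_finsetSum _ fun η _ =>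
      (tendsto_average_exp (θ - η)).const_mul _
  have hval : ∑ θ ∈ S, ∑ η ∈ S, ((e θ * e η : ℝ) : ℂ) * (if θ - η = 0 then 1 else 0) =
      (averageMixingMatrix G a b : ℂ) := by
    rw [averageMixingMatrix_apply, Complex.ofReal_sum]
    refine Finset.sum_congr rfl fun θ hθ => ?_
    rw [Finset.sum_eq_single_of_mem θ hθ]
    · simp [he, sq]
    · intro η _ hη
      rw [if_neg (sub_ne_zero.2 hη.symm), mul_zero]
  rw [← hval]
  refine hlim.congr fun T => ?_
  simp_rw [mixingMatrix_apply]
  rw [intervalIntegral.integral_finsetSum fun θ _ =>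
    Continuous.intervalIntegrable (by fun_prop) _ _, Finset.mul_sum]
  refine Finset.sum_congr rfl fun θ _ => ?_
  rw [intervalIntegral.integral_finsetSum fun η _ =>
    Continuous.intervalIntegrable (by fun_prop) _ _, Finset.mul_sum]
  refine Finset.sum_congr rfl fun η _ => ?_
  rw [intervalIntegral.integral_const_mul]
  ring

/-! ### Splitting a matrix over the rationals and the integers. -/

/-- The map `X ↦ A X - X A` on square matrices. -/
def commutatorMap {n : ℕ} {R : Type*} [CommRing R] (A : Matrix (Fin n) (Fin n) R) :
    Matrix (Fin n) (Fin n) R →ₗ[R] Matrix (Fin n) (Fin n) R :=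
  LinearMap.mulLeft R A - LinearMap.mulRight R A

theorem commutatorMap_apply {n : ℕ} {R : Type*} [CommRing R] (A X : Matrix (Fin n) (Fin n) R) :
    commutatorMap A X = A * X - X * A := rfl

/-- If `Z = A X - X A` commutes with `A`, so does `Zᵀ`, and cyclicity of the trace gives `tr(Zᵀ Z) =
0`. This is a sum of rational squares, so `Z = 0`. -/
theorem disjoint_ker_range_commutatorMap {n : ℕ} {A : Matrix (Fin n) (Fin n) ℚ} (hA : A.IsSymm) :
    Disjoint (LinearMap.ker (commutatorMap A)) (LinearMap.range (commutatorMap A)) := by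
  rw [Submodule.disjoint_def]
  rintro _ hker ⟨X, rfl⟩
  set Z := commutatorMap A X with hZ
  have hcomm : A * Z = Z * A := by
    rwa [LinearMap.mem_ker, commutatorMap_apply, sub_eq_zero] at hker
  have hT : Zᵀ * A = A * Zᵀ := by
    have := congrArg Matrix.transpose hcomm
    rwa [Matrix.transpose_mul, Matrix.transpose_mul, hA.eq] at this
  have htr : (Zᴴ * Z).trace = 0 := by
    rw [Matrix.conjTranspose_eq_transpose_of_trivial]
    nth_rewrite 2 [hZ]
    rw [commutatorMap_apply, Matrix.mul_sub, Matrix.trace_sub, ← Matrix.mul_assoc, hT,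
      ← Matrix.mul_assoc, Matrix.trace_mul_comm (Zᵀ * X), Matrix.mul_assoc, sub_self]
  exact Matrix.trace_conjTranspose_mul_self_eq_zero_iff.1 htr

/-- Every matrix is the sum of one commuting with a symmetric `A` and a commutator with `A`. -/
theorem exists_commute_sub_eq_commutator {n : ℕ} {A : Matrix (Fin n) (Fin n) ℚ} (hA : A.IsSymm)
    (D : Matrix (Fin n) (Fin n) ℚ) :
    ∃ X Y : Matrix (Fin n) (Fin n) ℚ, A * X = X * A ∧ D - X = A * Y - Y * A := by
  -- Rank-nullity turns disjointness of kernel and range into a direct sum decomposition.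
  have htop := Submodule.eq_top_of_disjoint _ _
    (by rw [add_comm, LinearMap.finrank_range_add_finrank_ker])
    (disjoint_ker_range_commutatorMap hA)
  obtain ⟨X, hX, _, ⟨Y, rfl⟩, hD⟩ :=
    Submodule.mem_sup.1 (htop ▸ Submodule.mem_top : D ∈ _)
  refine ⟨X, Y, ?_, ?_⟩
  · rwa [LinearMap.mem_ker, commutatorMap_apply, sub_eq_zero] at hX
  · rw [← commutatorMap_apply, ← hD]
    abel

theorem exists_pos_smul_eq_map_intCast {n : ℕ} (X Y : Matrix (Fin n) (Fin n) ℚ) :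
    ∃ q : ℕ, 0 < q ∧ ∃ X' Y' : Matrix (Fin n) (Fin n) ℤ,
      (q : ℚ) • X = X'.map (Int.cast : ℤ → ℚ) ∧ (q : ℚ) • Y = Y'.map (Int.cast : ℤ → ℚ) := by
  have key : ∀ x : ℚ, ∀ q : ℕ, x.den ∣ q → ∃ z : ℤ, (q : ℚ) * x = z := by
    rintro x _ ⟨k, rfl⟩
    refine ⟨k * x.num, ?_⟩
    push_cast
    rw [mul_comm (x.den : ℚ), mul_assoc, Rat.den_mul_eq_num]
  -- The common multiplier is the product of all denominators in both matrices.
  let d : Fin n × Fin n → ℕ := fun p => (X p.1 p.2).den * (Y p.1 p.2).den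
  have hd : ∀ i j, (X i j).den * (Y i j).den ∣ ∏ p, d p := fun i j =>
    Finset.dvd_prod_of_mem d (Finset.mem_univ (i, j))
  choose fX hX using fun i j => key (X i j) _ ((Dvd.intro _ rfl).trans (hd i j))
  choose fY hY using fun i j => key (Y i j) _ ((Dvd.intro_left _ rfl).trans (hd i j))
  refine ⟨∏ p, d p, Finset.prod_pos fun p _ => Nat.mul_pos (Rat.den_pos _) (Rat.den_pos _),
    Matrix.of fX, Matrix.of fY, ?_, ?_⟩
  · ext i j; simpa using hX i j
  · ext i j; simpa using hY i j

theorem exists_int_commute_sub_eq_commutator {n : ℕ} {A : Matrix (Fin n) (Fin n) ℤ}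
    (hA : A.IsSymm) (D : Matrix (Fin n) (Fin n) ℤ) :
    ∃ q : ℕ, 0 < q ∧ ∃ X Y : Matrix (Fin n) (Fin n) ℤ,
      A * X = X * A ∧ (q : ℤ) • D - X = A * Y - Y * A := by
  have hinj : Function.Injective ((Int.castRingHom ℚ).mapMatrix (m := Fin n)) :=
    Matrix.map_injective Int.cast_injective
  obtain ⟨X, Y, hX, hY⟩ := exists_commute_sub_eq_commutator (hA.map (Int.castRingHom ℚ))
    ((Int.castRingHom ℚ).mapMatrix D)
  obtain ⟨q, hq, X', Y', hX', hY'⟩ := exists_pos_smul_eq_map_intCast X Y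
  have hX'' : (Int.castRingHom ℚ).mapMatrix X' = (q : ℚ) • X := hX'.symm
  have hY'' : (Int.castRingHom ℚ).mapMatrix Y' = (q : ℚ) • Y := hY'.symm
  change (Int.castRingHom ℚ).mapMatrix A * X = X * (Int.castRingHom ℚ).mapMatrix A at hX
  change _ = (Int.castRingHom ℚ).mapMatrix A * Y - Y * (Int.castRingHom ℚ).mapMatrix A at hY
  refine ⟨q, hq, X', Y', hinj ?_, hinj ?_⟩
  · rw [map_mul, map_mul, hX'', Matrix.mul_smul, Matrix.smul_mul, hX]
  · rw [map_sub, map_sub, map_mul, map_mul, map_zsmul, hX'', hY'', Matrix.mul_smul,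
      Matrix.smul_mul, ← smul_sub, ← hY, smul_sub]
    simp only [Nat.cast_smul_eq_nsmul]

/-! ### Primitive recursion and unbounded search. -/

theorem primrec_sum_range {α : Type*} [Primcodable α] {f : α → ℕ} {g : α → ℕ → ℕ}
    (hf : Primrec f) (hg : Primrec₂ g) :
    Primrec fun a => ∑ k ∈ Finset.range (f a), g a k := by
  have h : Primrec₂ fun (a : α) (p : ℕ × ℕ) => p.2 + g a p.1 :=
    Primrec.nat_add.comp₂ (Primrec.snd.comp₂ Primrec₂.right)
      (hg.comp₂ Primrec₂.left (Primrec.fst.comp₂ Primrec₂.right))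
  refine (Primrec.nat_rec' hf (Primrec.const 0) h).of_eq fun a => ?_
  induction f a with
  | zero => rfl
  | succ n ih => rw [Finset.sum_range_succ, ← ih]

theorem primrecPred_forall_lt {α : Type*} [Primcodable α] {f : α → ℕ} {R : α → ℕ → Prop}
    (hf : Primrec f) (hR : PrimrecRel R) : PrimrecPred fun a => ∀ i < f a, R a i :=
  ((PrimrecRel.forall_mem_list (R := fun i a => R a i) hR.swap).comp
    (Primrec.list_range.comp hf) Primrec.id).of_eq fun a => by simp

theorem primrec_int_ofNat : Primrec Int.ofNat := by
  rw [← Primrec.encode_iff]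
  -- The code of a nonnegative integer `n` is `2 * n`.
  exact (Primrec.nat_mul.comp (Primrec.const 2) Primrec.id).of_eq fun n => rfl

/-- If a primitive recursive relation is left total, then unbounded search is a total computable
function choosing related elements. -/
theorem exists_computable_choice {α β : Type*} [Primcodable α] [Primcodable β]
    {R : α → β → Prop} (hR : PrimrecRel R) (h : ∀ a, ∃ b, R a b) :
    ∃ g : α → β, Computable g ∧ ∀ a, R a (g a) := by
  classical
  let f : α → ℕ → Option β := fun a n => (Encodable.decode n).bind fun b =>
    if R a b then some b else none
  have hf : Primrec₂ f := by
    refine Primrec.option_bind (Primrec.decode.comp Primrec.snd) ?_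
    exact Primrec.ite (hR.comp (Primrec.fst.comp Primrec.fst) Primrec.snd)
      (Primrec.option_some.comp Primrec.snd) (Primrec.const none)
  have hdom : ∀ a, (Nat.rfindOpt (f a)).Dom := by
    intro a
    obtain ⟨b, hb⟩ := h a
    exact Nat.rfindOpt_dom.2 ⟨Encodable.encode b, b, by simp [f, hb]⟩
  refine ⟨fun a => (Nat.rfindOpt (f a)).get (hdom a),
    (Partrec.rfindOpt hf.to_comp).of_eq_tot fun a => Part.get_mem _, fun a => ?_⟩
  obtain ⟨n, hn⟩ := Nat.rfindOpt_spec (Part.get_mem (hdom a))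
  obtain ⟨b, -, hb⟩ := Option.bind_eq_some_iff.1 hn
  split_ifs at hb with hab
  cases hb
  exact hab

/-! ### Matrices encoded by natural numbers. -/

/-- The `(i, j)` entry of the product of the leading `n × n` blocks of two infinite matrices. -/
def natMul (n : ℕ) (F G : ℕ → ℕ → ℕ) (i j : ℕ) : ℕ :=
  ∑ k ∈ Finset.range n, F i k * G k j

theorem primrec_natMul {α : Type*} [Primcodable α] {n i j : α → ℕ} {F G : α → ℕ → ℕ → ℕ}
    (hn : Primrec n) (hF : Primrec fun p : α × ℕ × ℕ => F p.1 p.2.1 p.2.2)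
    (hG : Primrec fun p : α × ℕ × ℕ => G p.1 p.2.1 p.2.2) (hi : Primrec i) (hj : Primrec j) :
    Primrec fun a => natMul (n a) (F a) (G a) (i a) (j a) := by
  refine primrec_sum_range hn (Primrec.nat_mul.comp ?_ ?_)
  · exact hF.comp (Primrec.fst.pair ((hi.comp Primrec.fst).pair Primrec.snd))
  · exact hG.comp (Primrec.fst.pair (Primrec.snd.pair (hj.comp Primrec.fst)))

/-- The leading `n × n` block of an infinite matrix of natural numbers. -/
def natBlock (n : ℕ) (F : ℕ → ℕ → ℕ) : Matrix (Fin n) (Fin n) ℤ :=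
  Matrix.of fun i j => (F i j : ℤ)

theorem natBlock_apply (n : ℕ) (F : ℕ → ℕ → ℕ) (i j : Fin n) : natBlock n F i j = F i j := rfl

theorem natMul_cast (n : ℕ) (F G : ℕ → ℕ → ℕ) (i j : Fin n) :
    (natMul n F G i j : ℤ) = (natBlock n F * natBlock n G) i j := by
  rw [natMul, Matrix.mul_apply, Finset.sum_range]
  push_cast
  rfl

/-- A list of natural numbers read as a matrix, indexed through the pairing function. -/
def tableEntry (l : List ℕ) (i j : ℕ) : ℕ := l.getD (Nat.pair i j) 0

theorem exists_tableEntry_eq {n : ℕ} (F : Fin n → Fin n → ℕ) :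
    ∃ l : List ℕ, ∀ i j : Fin n, tableEntry l i j = F i j := by
  classical
  refine ⟨(List.range (Nat.pair n n)).map fun k =>
    if h : k.unpair.1 < n ∧ k.unpair.2 < n then F ⟨_, h.1⟩ ⟨_, h.2⟩ else 0, fun i j => ?_⟩
  -- Pairing increases in each argument, so a list of length `Nat.pair n n` reaches every entry.
  have hlt : Nat.pair i j < Nat.pair n n :=
    (Nat.pair_lt_pair_left _ i.2).trans (Nat.pair_lt_pair_right _ j.2)
  rw [tableEntry, List.getD_eq_getElem?_getD]
  simp [hlt]

/-- Splitting entries into positive and negative parts keeps certificates within the natural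
numbers. -/
theorem exists_natBlock_sub_eq {n : ℕ} (X : Matrix (Fin n) (Fin n) ℤ) :
    ∃ l m : List ℕ, natBlock n (tableEntry l) - natBlock n (tableEntry m) = X := by
  obtain ⟨l, hl⟩ := exists_tableEntry_eq fun i j => (X i j).toNat
  obtain ⟨m, hm⟩ := exists_tableEntry_eq fun i j => (-X i j).toNat
  refine ⟨l, m, ?_⟩
  ext i j
  rw [Matrix.sub_apply, natBlock_apply, natBlock_apply, hl, hm, Int.toNat_sub_toNat_neg]

/-- The `(i, j)` entry of the symmetric 0-1 matrix read off from rows of bits. -/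
def bitEntry (rows : List (List Bool)) (i j : ℕ) : ℕ :=
  bif (rows.getD i []).getD j false && (rows.getD j []).getD i false then 1 else 0

/-- Symmetry for arbitrary rows, not only those of a graph, is what makes the search halt on every
input. -/
theorem bitEntry_comm (rows : List (List Bool)) (i j : ℕ) :
    bitEntry rows i j = bitEntry rows j i := by
  rw [bitEntry, bitEntry, Bool.and_comm]

theorem bitEntry_adjacencyRows {n : ℕ} (G : SimpleGraph (Fin n)) [DecidableRel G.Adj]
    (i j : Fin n) : bitEntry (adjacencyRows G) i j = if G.Adj i j then 1 else 0 := by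
  have h : ∀ i j : Fin n, ((adjacencyRows G).getD i []).getD j false = decide (G.Adj i j) := by
    intro i j
    simp [adjacencyRows, List.getD_eq_getElem?_getD]
  rw [bitEntry, h, h]
  by_cases hij : G.Adj i j <;> simp [hij, G.adj_comm j i]

/-- The dimension of the matrix described by an input: the number of rows, enlarged so that both
given indices are in range. -/
def inputSize (x : List (List Bool) × ℕ × ℕ) : ℕ :=
  max x.1.length (max (x.2.1 + 1) (x.2.2 + 1))

theorem inputSize_adjacencyRows {n : ℕ} (G : SimpleGraph (Fin n)) [DecidableRel G.Adj]
    (a b : Fin n) : inputSize (adjacencyRows G, (a : ℕ), (b : ℕ)) = n := by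
  have := a.2
  have := b.2
  simp only [inputSize, adjacencyRows, List.length_ofFn]
  omega

/-- The matrix `P - M` commutes with `A`, expressed without subtraction. -/
def CommuteBlock (n : ℕ) (A P M : ℕ → ℕ → ℕ) : Prop :=
  ∀ i < n, ∀ j < n,
    natMul n A P i j + natMul n M A i j = natMul n A M i j + natMul n P A i j

/-- The matrix with `q` in position `(b, b)` is `P - M` plus the commutator of `A` and `P' - M'`,
expressed without subtraction. -/
def CommutatorBlock (n : ℕ) (A P M P' M' : ℕ → ℕ → ℕ) (q b : ℕ) : Prop :=
  ∀ i < n, ∀ j < n,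
    (if i = b ∧ j = b then q else 0) + M i j + natMul n A M' i j + natMul n P' A i j =
      P i j + natMul n A P' i j + natMul n M' A i j

theorem commuteBlock_iff {n : ℕ} {A P M : ℕ → ℕ → ℕ} :
    CommuteBlock n A P M ↔ natBlock n A * (natBlock n P - natBlock n M) =
      (natBlock n P - natBlock n M) * natBlock n A := by
  rw [← Matrix.ext_iff, CommuteBlock, Fin.forall_iff]
  refine forall₂_congr fun i hi => ?_
  rw [Fin.forall_iff]
  refine forall₂_congr fun j hj => ?_
  rw [Matrix.mul_sub, Matrix.sub_mul, Matrix.sub_apply, Matrix.sub_apply, ← natMul_cast,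
    ← natMul_cast, ← natMul_cast, ← natMul_cast]
  dsimp only
  omega

theorem commutatorBlock_iff {n : ℕ} {A P M P' M' : ℕ → ℕ → ℕ} {q : ℕ} {b : Fin n} :
    CommutatorBlock n A P M P' M' q b ↔
      (q : ℤ) • Matrix.single b b 1 - (natBlock n P - natBlock n M) =
        natBlock n A * (natBlock n P' - natBlock n M') -
          (natBlock n P' - natBlock n M') * natBlock n A := by
  rw [← Matrix.ext_iff, CommutatorBlock, Fin.forall_iff]
  refine forall₂_congr fun i hi => ?_
  rw [Fin.forall_iff]
  refine forall₂_congr fun j hj => ?_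
  have h : ((q : ℤ) • Matrix.single b b (1 : ℤ)) ⟨i, hi⟩ ⟨j, hj⟩ =
      ((if i = b ∧ j = b then q else 0 : ℕ) : ℤ) := by
    rw [Matrix.smul_apply, Matrix.single_apply]
    simp only [Fin.ext_iff, eq_comm (a := (b : ℕ))]
    split_ifs <;> simp
  simp only [Matrix.mul_sub, Matrix.sub_mul, Matrix.sub_apply, h, ← natMul_cast, natBlock_apply]
  omega

/-! ### Certificates and their primitive recursive verification. -/

/-- Certificates: two differences of tables, a scaling factor, a fraction, and the Bézout
coefficients of that fraction. -/
abbrev Certificate : Type :=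
  ((List ℕ × List ℕ) × (List ℕ × List ℕ)) × ℕ × (ℕ × ℕ) × (ℕ × ℕ)

/-- The certificate `c` proves that the entry requested by the input `x` is the fraction that `c`
names. -/
def IsCertificate (x : List (List Bool) × ℕ × ℕ) (c : Certificate) : Prop :=
  (CommuteBlock (inputSize x) (bitEntry x.1) (tableEntry c.1.1.1) (tableEntry c.1.1.2) ∧
    CommutatorBlock (inputSize x) (bitEntry x.1) (tableEntry c.1.1.1) (tableEntry c.1.1.2)
      (tableEntry c.1.2.1) (tableEntry c.1.2.2) c.2.1 x.2.2) ∧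
  (0 < c.2.1 ∧
    tableEntry c.1.1.1 x.2.1 x.2.1 * c.2.2.1.2 =
      tableEntry c.1.1.2 x.2.1 x.2.1 * c.2.2.1.2 + c.2.2.1.1 * c.2.1 ∧
    c.2.2.1.2 * c.2.2.2.1 = c.2.2.1.1 * c.2.2.2.2 + 1)

theorem primrec_tableEntry {α : Type*} [Primcodable α] {l : α → List ℕ} {i j : α → ℕ}
    (hl : Primrec l) (hi : Primrec i) (hj : Primrec j) :
    Primrec fun a => tableEntry (l a) (i a) (j a) :=
  (Primrec.list_getD 0).comp hl (Primrec₂.natPair.comp hi hj)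

theorem primrec_bitEntry {α : Type*} [Primcodable α] {rows : α → List (List Bool)} {i j : α → ℕ}
    (hr : Primrec rows) (hi : Primrec i) (hj : Primrec j) :
    Primrec fun a => bitEntry (rows a) (i a) (j a) :=
  Primrec.cond (Primrec.and.comp
    ((Primrec.list_getD false).comp ((Primrec.list_getD []).comp hr hi) hj)
    ((Primrec.list_getD false).comp ((Primrec.list_getD []).comp hr hj) hi))
    (Primrec.const 1) (Primrec.const 0)

theorem primrec_inputSize : Primrec inputSize :=
  Primrec.nat_max.comp (Primrec.list_length.comp Primrec.fst)
    (Primrec.nat_max.comp (Primrec.succ.comp (Primrec.fst.comp Primrec.snd))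
      (Primrec.succ.comp (Primrec.snd.comp Primrec.snd)))

section

variable {α : Type*} [Primcodable α] {n q b : α → ℕ} {A P M P' M' : α → ℕ → ℕ → ℕ}

theorem primrecPred_forall_lt_forall_lt {R : α → ℕ → ℕ → Prop} (hn : Primrec n)
    (hR : PrimrecPred fun p : (α × ℕ) × ℕ => R p.1.1 p.1.2 p.2) :
    PrimrecPred fun a => ∀ i < n a, ∀ j < n a, R a i j :=
  primrecPred_forall_lt hn
    (primrecPred_forall_lt (R := fun p : α × ℕ => R p.1 p.2) (hn.comp Primrec.fst) hR)

theorem primrecPred_commuteBlock (hn : Primrec n)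
    (hA : Primrec fun p : α × ℕ × ℕ => A p.1 p.2.1 p.2.2)
    (hP : Primrec fun p : α × ℕ × ℕ => P p.1 p.2.1 p.2.2)
    (hM : Primrec fun p : α × ℕ × ℕ => M p.1 p.2.1 p.2.2) :
    PrimrecPred fun a => CommuteBlock (n a) (A a) (P a) (M a) := by
  have hfst : Primrec fun p : (α × ℕ) × ℕ => p.1.1 := Primrec.fst.comp Primrec.fst
  have hlift : ∀ {F : α → ℕ → ℕ → ℕ}, (Primrec fun p : α × ℕ × ℕ => F p.1 p.2.1 p.2.2) →
      Primrec fun p : ((α × ℕ) × ℕ) × ℕ × ℕ => F p.1.1.1 p.2.1 p.2.2 := fun hF =>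
    hF.comp ((hfst.comp Primrec.fst).pair Primrec.snd)
  have hmul : ∀ {F H : α → ℕ → ℕ → ℕ}, (Primrec fun p : α × ℕ × ℕ => F p.1 p.2.1 p.2.2) →
      (Primrec fun p : α × ℕ × ℕ => H p.1 p.2.1 p.2.2) →
      Primrec fun p : (α × ℕ) × ℕ => natMul (n p.1.1) (F p.1.1) (H p.1.1) p.1.2 p.2 :=
    fun hF hH => primrec_natMul (hn.comp hfst) (hlift hF) (hlift hH)
      (Primrec.snd.comp Primrec.fst) Primrec.snd
  exact primrecPred_forall_lt_forall_lt hn (Primrec.eq.comp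
    (Primrec.nat_add.comp (hmul hA hP) (hmul hM hA))
    (Primrec.nat_add.comp (hmul hA hM) (hmul hP hA)))

theorem primrecPred_commutatorBlock (hn : Primrec n) (hq : Primrec q) (hb : Primrec b)
    (hA : Primrec fun p : α × ℕ × ℕ => A p.1 p.2.1 p.2.2)
    (hP : Primrec fun p : α × ℕ × ℕ => P p.1 p.2.1 p.2.2)
    (hM : Primrec fun p : α × ℕ × ℕ => M p.1 p.2.1 p.2.2)
    (hP' : Primrec fun p : α × ℕ × ℕ => P' p.1 p.2.1 p.2.2)
    (hM' : Primrec fun p : α × ℕ × ℕ => M' p.1 p.2.1 p.2.2) :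
    PrimrecPred fun a =>
      CommutatorBlock (n a) (A a) (P a) (M a) (P' a) (M' a) (q a) (b a) := by
  have hfst : Primrec fun p : (α × ℕ) × ℕ => p.1.1 := Primrec.fst.comp Primrec.fst
  have hi : Primrec fun p : (α × ℕ) × ℕ => p.1.2 := Primrec.snd.comp Primrec.fst
  have hentry : ∀ {F : α → ℕ → ℕ → ℕ}, (Primrec fun p : α × ℕ × ℕ => F p.1 p.2.1 p.2.2) →
      Primrec fun p : (α × ℕ) × ℕ => F p.1.1 p.1.2 p.2 := fun hF =>
    hF.comp (hfst.pair (hi.pair Primrec.snd))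
  have hlift : ∀ {F : α → ℕ → ℕ → ℕ}, (Primrec fun p : α × ℕ × ℕ => F p.1 p.2.1 p.2.2) →
      Primrec fun p : ((α × ℕ) × ℕ) × ℕ × ℕ => F p.1.1.1 p.2.1 p.2.2 := fun hF =>
    hF.comp ((hfst.comp Primrec.fst).pair Primrec.snd)
  have hmul : ∀ {F H : α → ℕ → ℕ → ℕ}, (Primrec fun p : α × ℕ × ℕ => F p.1 p.2.1 p.2.2) →
      (Primrec fun p : α × ℕ × ℕ => H p.1 p.2.1 p.2.2) →
      Primrec fun p : (α × ℕ) × ℕ => natMul (n p.1.1) (F p.1.1) (H p.1.1) p.1.2 p.2 :=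
    fun hF hH => primrec_natMul (hn.comp hfst) (hlift hF) (hlift hH) hi Primrec.snd
  have hdiag : Primrec fun p : (α × ℕ) × ℕ =>
      if p.1.2 = b p.1.1 ∧ p.2 = b p.1.1 then q p.1.1 else 0 :=
    Primrec.ite ((Primrec.eq.comp hi (hb.comp hfst)).and
      (Primrec.eq.comp Primrec.snd (hb.comp hfst))) (hq.comp hfst) (Primrec.const 0)
  exact primrecPred_forall_lt_forall_lt hn (Primrec.eq.comp
    (Primrec.nat_add.comp (Primrec.nat_add.comp (Primrec.nat_add.comp hdiag (hentry hM))
      (hmul hA hM')) (hmul hP' hA))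
    (Primrec.nat_add.comp (Primrec.nat_add.comp (hentry hP) (hmul hA hP')) (hmul hM' hA)))

end

theorem primrecRel_isCertificate : PrimrecRel IsCertificate := by
  let T := (List (List Bool) × ℕ × ℕ) × Certificate
  have hx : Primrec fun p : T => p.1 := Primrec.fst
  have hc : Primrec fun p : T => p.2 := Primrec.snd
  have ha : Primrec fun p : T => p.1.2.1 := Primrec.fst.comp (Primrec.snd.comp hx)
  have hb : Primrec fun p : T => p.1.2.2 := Primrec.snd.comp (Primrec.snd.comp hx)
  have hX : Primrec fun p : T => p.2.1.1 := Primrec.fst.comp (Primrec.fst.comp hc)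
  have hY : Primrec fun p : T => p.2.1.2 := Primrec.snd.comp (Primrec.fst.comp hc)
  have hq : Primrec fun p : T => p.2.2.1 := Primrec.fst.comp (Primrec.snd.comp hc)
  have hf : Primrec fun p : T => p.2.2.2.1 :=
    Primrec.fst.comp (Primrec.snd.comp (Primrec.snd.comp hc))
  have hu : Primrec fun p : T => p.2.2.2.2 :=
    Primrec.snd.comp (Primrec.snd.comp (Primrec.snd.comp hc))
  have hn : Primrec fun p : T => inputSize p.1 := primrec_inputSize.comp hx
  have hi : Primrec fun p : T × ℕ × ℕ => p.2.1 := Primrec.fst.comp Primrec.snd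
  have hj : Primrec fun p : T × ℕ × ℕ => p.2.2 := Primrec.snd.comp Primrec.snd
  have hA : Primrec fun p : T × ℕ × ℕ => bitEntry p.1.1.1 p.2.1 p.2.2 :=
    primrec_bitEntry ((Primrec.fst.comp hx).comp Primrec.fst) hi hj
  have htab : ∀ {l : T → List ℕ}, Primrec l →
      Primrec fun p : T × ℕ × ℕ => tableEntry (l p.1) p.2.1 p.2.2 := fun hl =>
    primrec_tableEntry (hl.comp Primrec.fst) hi hj
  have hP := Primrec.fst.comp hX
  have hM := Primrec.snd.comp hX
  have hP' := Primrec.fst.comp hY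
  have hM' := Primrec.snd.comp hY
  have hnum := Primrec.fst.comp hf
  have hden := Primrec.snd.comp hf
  have hcomm : PrimrecPred fun p : T => CommuteBlock (inputSize p.1) (bitEntry p.1.1)
      (tableEntry p.2.1.1.1) (tableEntry p.2.1.1.2) :=
    primrecPred_commuteBlock (A := fun p : T => bitEntry p.1.1)
      (P := fun p : T => tableEntry p.2.1.1.1) (M := fun p : T => tableEntry p.2.1.1.2)
      hn hA (htab hP) (htab hM)
  have hcommutator : PrimrecPred fun p : T => CommutatorBlock (inputSize p.1) (bitEntry p.1.1)
      (tableEntry p.2.1.1.1) (tableEntry p.2.1.1.2) (tableEntry p.2.1.2.1)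
      (tableEntry p.2.1.2.2) p.2.2.1 p.1.2.2 :=
    primrecPred_commutatorBlock (A := fun p : T => bitEntry p.1.1)
      (P := fun p : T => tableEntry p.2.1.1.1) (M := fun p : T => tableEntry p.2.1.1.2)
      (P' := fun p : T => tableEntry p.2.1.2.1) (M' := fun p : T => tableEntry p.2.1.2.2)
      hn hq hb hA (htab hP) (htab hM) (htab hP') (htab hM')
  have hpos : PrimrecPred fun p : T => 0 < p.2.2.1 :=
    Primrec.nat_lt.comp (Primrec.const 0) hq
  have hfrac : PrimrecPred fun p : T => tableEntry p.2.1.1.1 p.1.2.1 p.1.2.1 * p.2.2.2.1.2 =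
      tableEntry p.2.1.1.2 p.1.2.1 p.1.2.1 * p.2.2.2.1.2 + p.2.2.2.1.1 * p.2.2.1 :=
    Primrec.eq.comp (Primrec.nat_mul.comp (primrec_tableEntry hP ha ha) hden)
      (Primrec.nat_add.comp (Primrec.nat_mul.comp (primrec_tableEntry hM ha ha) hden)
        (Primrec.nat_mul.comp hnum hq))
  have hbez : PrimrecPred fun p : T => p.2.2.2.1.2 * p.2.2.2.2.1 =
      p.2.2.2.1.1 * p.2.2.2.2.2 + 1 :=
    Primrec.eq.comp (Primrec.nat_mul.comp hden (Primrec.fst.comp hu))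
      (Primrec.succ.comp (Primrec.nat_mul.comp hnum (Primrec.snd.comp hu)))
  exact (hcomm.and hcommutator).and (hpos.and (hfrac.and hbez))

/-! ### Existence and soundness of certificates. -/

theorem natCast_mul_sum_eigenprojection_sq {n : ℕ} {A X Y : Matrix (Fin n) (Fin n) ℤ} {q : ℕ}
    {b : Fin n} (hA : A.IsSymm) (hX : A * X = X * A)
    (hY : (q : ℤ) • Matrix.single b b 1 - X = A * Y - Y * A) (a : Fin n) :
    (q : ℝ) * ∑ θ ∈ (A.map (Int.castRingHom ℝ)).charpoly.roots.toFinset,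
      eigenprojection (A.map (Int.castRingHom ℝ)) θ a b ^ 2 = X a a := by
  have hA' : (A.map (Int.castRingHom ℝ)).IsHermitian := by
    rw [Matrix.IsHermitian, Matrix.conjTranspose_eq_transpose_of_trivial]
    exact hA.map _
  have hX' := congrArg (Int.castRingHom ℝ).mapMatrix hX
  have hY' := congrArg (Int.castRingHom ℝ).mapMatrix hY
  rw [map_mul, map_mul] at hX'
  rw [map_sub, map_sub, map_mul, map_mul, map_zsmul] at hY'
  refine mul_sum_eigenprojection_sq hA' hX' (Eq.trans ?_ hY') a
  congr 1
  ext i j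
  simp [Matrix.single_apply]

/-- Bézout with natural coefficients certifies coprimality by one equation without subtraction. -/
theorem exists_natCast_bezout {m d : ℕ} (hd : 0 < d) (h : Nat.Coprime m d) :
    ∃ v u : ℕ, d * v = m * u + 1 := by
  rcases Nat.eq_zero_or_pos m with rfl | hm
  · exact ⟨1, 0, by simpa using h⟩
  obtain ⟨z, hz0, hz1⟩ := Nat.chineseRemainder h.symm 0 1
  -- Adding `d * m` preserves both congruences and makes the number at least `1`, so that `1` can be
  -- subtracted in `ℕ`.
  obtain ⟨v, hv⟩ : d ∣ z + d * m :=
    dvd_add ((Nat.modEq_zero_iff_dvd).1 hz0) (dvd_mul_right d m)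
  have hpos : 1 ≤ z + d * m := le_add_left (Nat.mul_pos hd hm)
  have hmod : 1 ≡ z + d * m [MOD m] := by
    simpa using (hz1.symm.add ((Nat.modEq_zero_iff_dvd).2 (dvd_mul_left m d)).symm)
  obtain ⟨u, hu⟩ := (Nat.modEq_iff_dvd' hpos).1 hmod
  exact ⟨v, u, by omega⟩

theorem coprime_of_mul_eq_mul_add_one {m d v u : ℕ} (h : d * v = m * u + 1) : Nat.Coprime m d := by
  refine Nat.dvd_one.1 ?_
  rw [← Nat.dvd_add_right ((Nat.gcd_dvd_left m d).mul_right u), ← h]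
  exact (Nat.gcd_dvd_right m d).mul_right v

theorem exists_isCertificate (x : List (List Bool) × ℕ × ℕ) : ∃ c, IsCertificate x c := by
  obtain ⟨rows, a, b⟩ := x
  set n := inputSize (rows, a, b) with hn
  have ha : a < n := by simp only [hn, inputSize]; omega
  have hb : b < n := by simp only [hn, inputSize]; omega
  have hA : (natBlock n (bitEntry rows)).IsSymm :=
    Matrix.IsSymm.ext fun i j => by rw [natBlock_apply, natBlock_apply, bitEntry_comm]
  obtain ⟨q, hq, X, Y, hX, hY⟩ :=
    exists_int_commute_sub_eq_commutator hA (Matrix.single (⟨b, hb⟩ : Fin n) ⟨b, hb⟩ 1)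
  have hval := natCast_mul_sum_eigenprojection_sq hA hX hY ⟨a, ha⟩
  -- This entry is `q` times a sum of squares, so the numerator can be a natural number.
  have hnonneg : 0 ≤ X ⟨a, ha⟩ ⟨a, ha⟩ := by
    have : (0 : ℝ) ≤ X ⟨a, ha⟩ ⟨a, ha⟩ := hval ▸ by positivity
    exact_mod_cast this
  obtain ⟨y, hy⟩ := Int.eq_ofNat_of_zero_le hnonneg
  obtain ⟨P, M, hPM⟩ := exists_natBlock_sub_eq X
  obtain ⟨P', M', hPM'⟩ := exists_natBlock_sub_eq Y
  have hg : 0 < Nat.gcd y q := Nat.gcd_pos_of_pos_right _ hq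
  -- The fraction is `y / q` in lowest terms, where `y` is the diagonal entry of `X`.
  obtain ⟨v, u, hvu⟩ := exists_natCast_bezout
    (Nat.div_pos (Nat.gcd_le_right y hq) hg) (Nat.coprime_div_gcd_div_gcd hg)
  refine ⟨((((P, M), (P', M')), q, (y / Nat.gcd y q, q / Nat.gcd y q), (v, u)) : Certificate),
    ⟨?_, ?_⟩, hq, ?_, hvu⟩
  · exact commuteBlock_iff.2 (by rw [hPM]; exact hX)
  · exact commutatorBlock_iff (b := ⟨b, hb⟩).2 (by rw [hPM, hPM']; exact hY)
  · have h1 := congrFun (congrFun hPM ⟨a, ha⟩) ⟨a, ha⟩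
    rw [Matrix.sub_apply, natBlock_apply, natBlock_apply, hy] at h1
    dsimp only at h1 ⊢
    have h2 : tableEntry P a a = tableEntry M a a + y := by omega
    rw [h2, add_mul, ← Nat.mul_div_assoc y (Nat.gcd_dvd_right y q), mul_comm (y / _),
      ← Nat.mul_div_assoc q (Nat.gcd_dvd_left y q), mul_comm q y]

theorem natBlock_bitEntry_adjacencyRows {n : ℕ} (G : SimpleGraph (Fin n)) [DecidableRel G.Adj] :
    natBlock n (bitEntry (adjacencyRows G)) = G.adjMatrix ℤ := by
  ext i j
  rw [natBlock_apply, bitEntry_adjacencyRows, SimpleGraph.adjMatrix_apply]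
  split_ifs <;> simp

/-- A zero denominator would turn the Bézout equation into `0 = m * u + 1`. -/
theorem IsCertificate.den_pos {x : List (List Bool) × ℕ × ℕ} {c : Certificate}
    (hc : IsCertificate x c) : 0 < c.2.2.1.2 := by
  refine Nat.pos_of_ne_zero fun h => ?_
  have hbez := hc.2.2.2
  rw [h, zero_mul] at hbez
  omega

/-- Soundness holds for whichever certificate the search meets: `X` is determined by `q`, and `Y`
does not affect the value. -/
theorem IsCertificate.averageMixingMatrix_eq {n : ℕ} {G : SimpleGraph (Fin n)}
    [DecidableRel G.Adj] {a b : Fin n} {c : Certificate}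
    (hc : IsCertificate (adjacencyRows G, (a : ℕ), (b : ℕ)) c) :
    averageMixingMatrix G a b = (c.2.2.1.1 : ℝ) / (c.2.2.1.2 : ℝ) := by
  have hden := hc.den_pos
  obtain ⟨⟨hX, hY⟩, hq, hfrac, -⟩ := hc
  rw [inputSize_adjacencyRows] at hX hY
  have hX' := commuteBlock_iff.1 hX
  have hY' := commutatorBlock_iff.1 hY
  dsimp only at hX' hY' hfrac
  rw [natBlock_bitEntry_adjacencyRows] at hX' hY'
  have hval := natCast_mul_sum_eigenprojection_sq G.isSymm_adjMatrix hX' hY' a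
  have hmap : (G.adjMatrix ℤ).map (Int.castRingHom ℝ) = G.adjMatrix ℝ := by
    ext i j
    by_cases h : G.Adj i j <;> simp [SimpleGraph.adjMatrix_apply, h]
  rw [hmap, ← averageMixingMatrix_apply, Matrix.sub_apply, natBlock_apply, natBlock_apply] at hval
  have hden' : (c.2.2.1.2 : ℝ) ≠ 0 := by exact_mod_cast hden.ne'
  have hq' : (c.2.1 : ℝ) ≠ 0 := by exact_mod_cast hq.ne'
  have hfrac' := congrArg (Nat.cast : ℕ → ℝ) hfrac
  push_cast at hfrac' hval
  rw [eq_div_iff hden']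
  apply mul_left_cancel₀ hq'
  rw [← mul_assoc, hval]
  linarith

theorem IsCertificate.coprime {x : List (List Bool) × ℕ × ℕ} {c : Certificate}
    (hc : IsCertificate x c) : Nat.Coprime c.2.2.1.1 c.2.2.1.2 :=
  coprime_of_mul_eq_mul_add_one hc.2.2.2

end QuantumWalk

theorem theorem2p3 :
    ∃ f : List (List Bool) × ℕ × ℕ → ℤ × ℕ, Computable f ∧
      ∀ (n : ℕ) (G : SimpleGraph (Fin n)) [DecidableRel G.Adj] (a b : Fin n)
        (num : ℤ) (den : ℕ),
        f (QuantumWalk.adjacencyRows G, (a : ℕ), (b : ℕ)) = (num, den) →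
          0 < den ∧ Nat.Coprime num.natAbs den ∧
          QuantumWalk.averageMixingMatrix G a b = (num : ℝ) / (den : ℝ) ∧
          Tendsto
            (fun T : ℝ => ((1 / T : ℝ) : ℂ) * ∫ t in (0 : ℝ)..T, QuantumWalk.mixingMatrix G t a b)
            atTop (𝓝 ((num : ℂ) / (den : ℂ))) := by
  obtain ⟨g, hg, hspec⟩ := QuantumWalk.exists_computable_choice
    QuantumWalk.primrecRel_isCertificate QuantumWalk.exists_isCertificate
  have hfrac : Computable fun x => (g x).2.2.1 :=
    Computable.fst.comp (Computable.snd.comp (Computable.snd.comp hg))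
  refine ⟨fun x => (Int.ofNat (g x).2.2.1.1, (g x).2.2.1.2),
    (QuantumWalk.primrec_int_ofNat.to_comp.comp (Computable.fst.comp hfrac)).pair
      (Computable.snd.comp hfrac), ?_⟩
  intro n G _ a b num den h
  obtain ⟨rfl, rfl⟩ := Prod.mk.inj h
  have hc := hspec (QuantumWalk.adjacencyRows G, (a : ℕ), (b : ℕ))
  have hM := hc.averageMixingMatrix_eq
  refine ⟨hc.den_pos, hc.coprime, by simpa using hM, ?_⟩
  have hlim := QuantumWalk.tendsto_average_mixingMatrix G a b
  rw [hM] at hlim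
  simpa using hlim
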